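/- Let $n\ge 1$, let $\mathbb C(q)$ be the field of rational functions in a formal parameter $q$, and put $\varepsilon=q-q^{-1}$. The spin Hecke algebra $\mathcal H_n^-$ is the unital associative $\mathbb C(q)$-algebra generated by $R_1,\dots,R_{n-1}$ subject to $$R_i^2=-\varepsilon^2-2,\qquad R_iR_j=-R_jR_i\ (|i-j|>1),\qquad R_iR_{i+1}R_i-R_{i+1}R_iR_{i+1}=\varepsilon^2(R_{i+1}-R_i).$$ The spin affine Hecke algebra $\widehat{\mathcal H}_n^-$ is the unital associative $\mathbb C(q)$-algebra generated by $R_i$ $(1\le i\le n-1)$ and $p_i,q_i$ $(1\le i\le n)$ subject to the above relations for the $R_i$ together with $$p_ip_j=p_jp_i,\quad q_iq_j=-q_jq_i\ (i\ne j),\quad p_i^2+q_i^2=1,\quad p_iq_j=q_jp_i\ (\text{all } i,j),$$ $$R_ip_j=p_jR_i,\quad R_iq_j=-q_jR_i\quad (j\ne i,i+1),$$ $$R_ip_i=p_{i+1}R_i+\varepsilon(q_i-q_{i+1}),\qquad R_iq_i=-q_{i+1}R_i-\varepsilon(p_i+p_{i+1}).$$ Let $\iota:\mathcal H_n^-\to\widehat{\mathcal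 H}_n^-$ be the canonical homomorphism $R_i\mapsto R_i$. Proposition. There exists a unique $\mathbb C(q)$-algebra homomorphism $\mathcal{JM}:\widehat{\mathcal H}_n^-\to\mathcal H_n^-$ which extends the identity map of $\mathcal H_n^-$ (that is, $\mathcal{JM}\circ\iota=\mathrm{id}$) and satisfies $\mathcal{JM}(p_1)=1$ and $\mathcal{JM}(q_1)=0$. Moreover the images $\mathfrak p_i=\mathcal{JM}(p_i)$ and $\mathfrak q_i=\mathcal{JM}(q_i)$ $(1\le i\le n)$, called the Jucys–Murphy elements of $\mathcal H_n^-$, are the elements given recursively by $\mathfrak p_1=1$, $\mathfrak q_1=0$ and, for $1\le i\le n-1$, $$\mathfrak p_{i+1}=-\tfrac12R_i\mathfrak p_iR_i+\tfrac{\varepsilon}{2}(\mathfrak q_iR_i+R_i\mathfrak q_i)+\tfrac{\varepsilon^2}{2}\mathfrak p_i,\qquad \mathfrak q_{i+1}=\tfrac12R_i\mathfrak q_iR_i+\tfrac{\varepsilon}{2}(\mathfrak p_iR_i+R_i\mathfrak p_i)-\tfrac{\varepsilon^2}{2}\mathfrak q_i.$$ -/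

import Mathlib

noncomputable section

namespace SpinHecke

/-- The ground field `ℂ(q)` of rational functions in a formal parameter. -/
abbrev K : Type := RatFunc ℂ

/-- The formal parameter `q`. -/
def qParam : K := RatFunc.X

/-- `ε = q - q⁻¹`. -/
def eps : K := qParam - qParam⁻¹

/-- The index `i` in `{1, …, n}` of a generator `R_i` with `1 ≤ i ≤ n - 1`.
All indices are shifted down by one, so `Fin n` is `{0, …, n - 1}`. -/
def lo {n : ℕ} (i : Fin (n - 1)) : Fin n := ⟨i.1, by have := i.2; omega⟩

/-- The index `i + 1` in `{1, …, n}` of a generator `R_i` with `1 ≤ i ≤ n - 1`. -/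
def hi {n : ℕ} (i : Fin (n - 1)) : Fin n := ⟨i.1 + 1, by have := i.2; omega⟩

/-! ### The spin Hecke algebra -/

/-- The free generator `R_i`. -/
abbrev fR {n : ℕ} (i : Fin (n - 1)) : FreeAlgebra K (Fin (n - 1)) := FreeAlgebra.ι K i

/-- The defining relations of the spin Hecke algebra. -/
inductive Rel (n : ℕ) :
    FreeAlgebra K (Fin (n - 1)) → FreeAlgebra K (Fin (n - 1)) → Prop
  | sq (i : Fin (n - 1)) :
      Rel n (fR i ^ 2) (algebraMap K _ (-eps ^ 2 - 2))
  | anticomm (i j : Fin (n - 1)) (h : i.1 + 1 < j.1 ∨ j.1 + 1 < i.1) :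
      Rel n (fR i * fR j) (-(fR j * fR i))
  | braid (i j : Fin (n - 1)) (h : j.1 = i.1 + 1) :
      Rel n (fR i * fR j * fR i - fR j * fR i * fR j) (eps ^ 2 • (fR j - fR i))

/-- The spin Hecke algebra `H_n^-` over `ℂ(q)`. -/
abbrev Alg (n : ℕ) : Type := RingQuot (Rel n)

/-- The generator `R_i` of `H_n^-`. -/
def R {n : ℕ} (i : Fin (n - 1)) : Alg n := RingQuot.mkAlgHom K (Rel n) (fR i)

/-! ### The spin affine Hecke algebra -/

/-- The symbols `R_i` (`1 ≤ i ≤ n - 1`) and `p_i`, `q_i` (`1 ≤ i ≤ n`). -/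
inductive Gen (n : ℕ) : Type
  | R (i : Fin (n - 1)) : Gen n
  | p (i : Fin n) : Gen n
  | q (i : Fin n) : Gen n

/-- The free generator `R_i`. -/
abbrev gR {n : ℕ} (i : Fin (n - 1)) : FreeAlgebra K (Gen n) := FreeAlgebra.ι K (Gen.R i)

/-- The free generator `p_i`. -/
abbrev gp {n : ℕ} (i : Fin n) : FreeAlgebra K (Gen n) := FreeAlgebra.ι K (Gen.p i)

/-- The free generator `q_i`. -/
abbrev gq {n : ℕ} (i : Fin n) : FreeAlgebra K (Gen n) := FreeAlgebra.ι K (Gen.q i)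

/-- The defining relations of the spin affine Hecke algebra. -/
inductive AffRel (n : ℕ) : FreeAlgebra K (Gen n) → FreeAlgebra K (Gen n) → Prop
  | sq (i : Fin (n - 1)) :
      AffRel n (gR i ^ 2) (algebraMap K _ (-eps ^ 2 - 2))
  | anticomm (i j : Fin (n - 1)) (h : i.1 + 1 < j.1 ∨ j.1 + 1 < i.1) :
      AffRel n (gR i * gR j) (-(gR j * gR i))
  | braid (i j : Fin (n - 1)) (h : j.1 = i.1 + 1) :
      AffRel n (gR i * gR j * gR i - gR j * gR i * gR j) (eps ^ 2 • (gR j - gR i))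
  | pp (i j : Fin n) : AffRel n (gp i * gp j) (gp j * gp i)
  | qq (i j : Fin n) (h : i ≠ j) : AffRel n (gq i * gq j) (-(gq j * gq i))
  | circle (i : Fin n) : AffRel n (gp i ^ 2 + gq i ^ 2) 1
  | pq (i j : Fin n) : AffRel n (gp i * gq j) (gq j * gp i)
  | Rp_far (i : Fin (n - 1)) (j : Fin n) (h : j ≠ lo i) (h' : j ≠ hi i) :
      AffRel n (gR i * gp j) (gp j * gR i)
  | Rq_far (i : Fin (n - 1)) (j : Fin n) (h : j ≠ lo i) (h' : j ≠ hi i) :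
      AffRel n (gR i * gq j) (-(gq j * gR i))
  | Rp (i : Fin (n - 1)) :
      AffRel n (gR i * gp (lo i)) (gp (hi i) * gR i + eps • (gq (lo i) - gq (hi i)))
  | Rq (i : Fin (n - 1)) :
      AffRel n (gR i * gq (lo i)) (-(gq (hi i) * gR i) - eps • (gp (lo i) + gp (hi i)))

/-- The spin affine Hecke algebra over `ℂ(q)`. -/
abbrev Aff (n : ℕ) : Type := RingQuot (AffRel n)

/-- The generator `R_i` of the spin affine Hecke algebra. -/
def aR {n : ℕ} (i : Fin (n - 1)) : Aff n := RingQuot.mkAlgHom K (AffRel n) (gR i)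

/-- The generator `p_i` of the spin affine Hecke algebra. -/
def p {n : ℕ} (i : Fin n) : Aff n := RingQuot.mkAlgHom K (AffRel n) (gp i)

/-- The generator `q_i` of the spin affine Hecke algebra. -/
def q {n : ℕ} (i : Fin n) : Aff n := RingQuot.mkAlgHom K (AffRel n) (gq i)

/-- The images of the `R_i` satisfy the relations of `H_n^-`. -/
theorem incl_rel (n : ℕ) ⦃x y : FreeAlgebra K (Fin (n - 1))⦄ (h : Rel n x y) :
    FreeAlgebra.lift K (fun i : Fin (n - 1) => (aR i : Aff n)) x =
      FreeAlgebra.lift K (fun i : Fin (n - 1) => (aR i : Aff n)) y := by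
  cases h with
  | sq i =>
    have := RingQuot.mkAlgHom_rel K (AffRel.sq i)
    simpa [aR] using this
  | anticomm i j h =>
    have := RingQuot.mkAlgHom_rel K (AffRel.anticomm i j h)
    simpa [aR] using this
  | braid i j h =>
    have := RingQuot.mkAlgHom_rel K (AffRel.braid i j h)
    simpa [aR] using this

/-- The canonical homomorphism from `H_n^-` to the spin affine Hecke algebra, `R_i ↦ R_i`. -/
def incl (n : ℕ) : Alg n →ₐ[K] Aff n :=
  RingQuot.liftAlgHom K
    ⟨FreeAlgebra.lift K (fun i : Fin (n - 1) => (aR i : Aff n)), incl_rel n⟩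

theorem incl_R {n : ℕ} (i : Fin (n - 1)) : incl n (R i) = aR i := by
  simp [incl, R, fR]

/-! ### Jucys-Murphy elements -/

/-- The pair `(𝔭_k, 𝔮_k)` of elements of `H_n^-` (indices shifted down by one). -/
def jucysMurphy (n : ℕ) : (k : ℕ) → k < n → Alg n × Alg n
  | 0, _ => (1, 0)
  | k + 1, h =>
    let P : Alg n := (jucysMurphy n k (by omega)).1
    let Q : Alg n := (jucysMurphy n k (by omega)).2
    let r : Alg n := R ⟨k, by omega⟩
    (-((1 / 2 : K) • (r * P * r)) + (eps / 2) • (Q * r + r * Q) + (eps ^ 2 / 2) • P,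
      (1 / 2 : K) • (r * Q * r) + (eps / 2) • (P * r + r * P) - (eps ^ 2 / 2) • Q)

/-- The even Jucys-Murphy element `𝔭_i` of `H_n^-`. -/
def jmP {n : ℕ} (i : Fin n) : Alg n := (jucysMurphy n i.1 i.2).1

/-- The odd Jucys-Murphy element `𝔮_i` of `H_n^-`. -/
def jmQ {n : ℕ} (i : Fin n) : Alg n := (jucysMurphy n i.1 i.2).2

/-- `JM` extends the identity of `H_n^-`, sends `p_1` to `1` and sends `q_1` to `0`. -/
structure IsJM {n : ℕ} (hn : 0 < n) (JM : Aff n →ₐ[K] Alg n) : Prop where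
  extends_id : ∀ x : Alg n, JM (incl n x) = x
  map_p : JM (p ⟨0, hn⟩) = 1
  map_q : JM (q ⟨0, hn⟩) = 0

end SpinHecke

end

/-! Since `r² = -ε² - 2` is a scalar, the two mixed relations between `R_i` and index `i` determine
the pair at index `i + 1` and are solved by the stated recursion (`eq_next`, `mul_P_eq`,
`mul_Q_eq`). This gives uniqueness and the formulas.

For existence, the recursive pairs must satisfy the other affine relations. The circle relation and
`𝔭𝔮 = 𝔮𝔭` pass together from one index to the next (`next_circle`). The far relations with `R_i`
follow from anticommutation of distant generators, except at index `i + 2`, where the braid relation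
enters (`supercommute_next_next`). Relations between pairs at different indices then follow, because
the lower pair is built from generators that supercommute with the higher one. -/

namespace SpinHecke

/-! ### One step of the recursion in an arbitrary algebra. -/

section Recursion

variable {F A : Type*} [Field F] [CharZero F] [Ring A] [Algebra F A]

/-- One step of the recursion for the even Jucys-Murphy elements. -/
def nextP (e : F) (r P Q : A) : A :=
  -((1 / 2 : F) • (r * P * r)) + (e / 2) • (Q * r + r * Q) + (e ^ 2 / 2) • P

/-- One step of the recursion for the odd Jucys-Murphy elements. -/
def nextQ (e : F) (r P Q : A) : A :=
  (1 / 2 : F) • (r * Q * r) + (e / 2) • (P * r + r * P) - (e ^ 2 / 2) • Q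

variable {e : F} {r s t x P Q : A}

omit [CharZero F] in
theorem mul_self_mul (hr : r * r = (-e ^ 2 - 2) • (1 : A)) (x : A) :
    r * (r * x) = (-e ^ 2 - 2) • x := by
  rw [← mul_assoc, hr, smul_mul_assoc, one_mul]

theorem mul_P_eq (hr : r * r = (-e ^ 2 - 2) • (1 : A)) :
    r * P = nextP e r P Q * r + e • (Q - nextQ e r P Q) := by
  simp only [nextP, nextQ, add_mul, neg_mul, smul_mul_assoc,
    mul_smul_comm, mul_assoc, hr, mul_one]
  module

theorem mul_Q_eq (hr : r * r = (-e ^ 2 - 2) • (1 : A)) :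
    r * Q = -(nextQ e r P Q * r) - e • (P + nextP e r P Q) := by
  simp only [nextP, nextQ, add_mul, sub_mul, smul_mul_assoc,
    mul_smul_comm, mul_assoc, hr, mul_one]
  module

/-- With `mul_nextQ`, this moves `r` rightwards through products of the new pair, as `next_circle`
requires. -/
theorem mul_nextP (hr : r * r = (-e ^ 2 - 2) • (1 : A)) :
    r * nextP e r P Q = P * r + e • (nextQ e r P Q - Q) := by
  simp only [nextP, nextQ, mul_add, mul_neg,
    mul_smul_comm, mul_assoc, mul_self_mul hr]
  module

theorem mul_nextQ (hr : r * r = (-e ^ 2 - 2) • (1 : A)) :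
    r * nextQ e r P Q = -(Q * r) - e • (P + nextP e r P Q) := by
  simp only [nextP, nextQ, mul_add, mul_sub,
    mul_smul_comm, mul_assoc, mul_self_mul hr]
  module

/-- The exchange relations determine the next pair. -/
theorem eq_next {P' Q' : A} (hr : r * r = (-e ^ 2 - 2) • (1 : A))
    (hP : r * P = P' * r + e • (Q - Q')) (hQ : r * Q = -(Q' * r) - e • (P + P')) :
    P' = nextP e r P Q ∧ Q' = nextQ e r P Q := by
  constructor
  · simp only [nextP, hP, hQ, add_mul, sub_mul, smul_mul_assoc, mul_assoc, hr,
      mul_smul_comm, mul_one]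
    module
  · simp only [nextQ, hP, hQ, add_mul, sub_mul, neg_mul, smul_mul_assoc, mul_assoc, hr,
      mul_smul_comm, mul_one]
    module

/-- The circle relation and the commutation of the two components pass to the next pair. -/
theorem next_circle (hr : r * r = (-e ^ 2 - 2) • (1 : A))
    (hc : P * P + Q * Q = 1) (hPQ : P * Q = Q * P) :
    nextP e r P Q * nextP e r P Q + nextQ e r P Q * nextQ e r P Q = 1 ∧
      nextP e r P Q * nextQ e r P Q = nextQ e r P Q * nextP e r P Q := by
  have h1 := mul_nextP (P := P) (Q := Q) hr
  have h2 := mul_nextQ (P := P) (Q := Q) hr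
  generalize nextP e r P Q = P' at h1 h2 ⊢
  generalize nextQ e r P Q = Q' at h1 h2 ⊢
  have h1' (x : A) : r * (P' * x) = (P * r + e • (Q' - Q)) * x := by rw [← mul_assoc, h1]
  have h2' (x : A) : r * (Q' * x) = (-(Q * r) - e • (P + P')) * x := by rw [← mul_assoc, h2]
  have hc' : Q * (Q * r) = r - P * (P * r) := by
    rw [eq_sub_iff_add_eq', ← mul_assoc, ← mul_assoc, ← add_mul, hc, one_mul]
  have hQQ : Q * Q = 1 - P * P := eq_sub_of_add_eq' hc
  have hPQ' : P * (Q * r) = Q * (P * r) := by rw [← mul_assoc, hPQ, mul_assoc]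
  -- With `X = P'² + Q'² - 1` and `Y = P'Q' - Q'P'`, left multiplication by `r` swaps the two
  -- defects: `rX = -eY` and `rY = eX`.
  have k1 : r * (P' * P' + Q' * Q' - 1) = -(e • (P' * Q' - Q' * P')) := by
    simp only [mul_add, add_mul, mul_sub, sub_mul, neg_mul, mul_neg, smul_mul_assoc,
      mul_smul_comm, mul_assoc, mul_one, h1, h2, h1', h2', hc', hPQ]
    module
  have k2 : r * (P' * Q' - Q' * P') = e • (P' * P' + Q' * Q' - 1) := by
    simp only [mul_add, add_mul, mul_sub, sub_mul, neg_mul, mul_neg, smul_mul_assoc,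
      mul_smul_comm, mul_assoc, h1, h2, h1', h2', hQQ, hPQ']
    module
  -- Applying `r` twice gives `r²X = -e²X`, while `r² = -e² - 2`; hence `2X = 0`. The same argument
  -- kills `Y`.
  have k3 : (2 : F) • (P' * P' + Q' * Q' - 1) = 0 := by
    have := mul_self_mul hr (P' * P' + Q' * Q' - 1)
    rw [k1, mul_neg, mul_smul_comm, k2] at this
    linear_combination (norm := module) this
  have k4 : (2 : F) • (P' * Q' - Q' * P') = 0 := by
    have := mul_self_mul hr (P' * Q' - Q' * P')
    rw [k2, mul_smul_comm, k1] at this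
    linear_combination (norm := module) this
  rw [smul_eq_zero_iff_right two_ne_zero, sub_eq_zero] at k3 k4
  exact ⟨k3, k4⟩

omit [CharZero F] in
/-- An element commuting with the data commutes with the next pair. -/
theorem commute_next (hP : x * P = P * x) (hQ : x * Q = Q * x) (hr : x * r = r * x) :
    x * nextP e r P Q = nextP e r P Q * x ∧ x * nextQ e r P Q = nextQ e r P Q * x := by
  have cP : Commute x P := hP
  have cQ : Commute x Q := hQ
  have cr : Commute x r := hr
  constructor
  · exact ((((cr.mul_right cP).mul_right cr).smul_right _).neg_right.add_right
      (((cQ.mul_right cr).add_right (cr.mul_right cQ)).smul_right _)).add_right (cP.smul_right _)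
  · exact ((((cr.mul_right cQ).mul_right cr).smul_right _).add_right
      (((cP.mul_right cr).add_right (cr.mul_right cP)).smul_right _)).sub_right (cQ.smul_right _)

omit [CharZero F] in
/-- An odd element supercommuting with the data supercommutes with the next pair. -/
theorem supercommute_next (hP : t * P = P * t) (hQ : t * Q = -(Q * t)) (hr : t * r = -(r * t)) :
    t * nextP e r P Q = nextP e r P Q * t ∧ t * nextQ e r P Q = -(nextQ e r P Q * t) := by
  have hP' (x : A) : t * (P * x) = P * (t * x) := by rw [← mul_assoc, hP, mul_assoc]
  have hQ' (x : A) : t * (Q * x) = -(Q * (t * x)) := by rw [← mul_assoc, hQ, neg_mul, mul_assoc]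
  have hr' (x : A) : t * (r * x) = -(r * (t * x)) := by rw [← mul_assoc, hr, neg_mul, mul_assoc]
  constructor
  · simp only [nextP, mul_add, add_mul, neg_mul, mul_neg, smul_mul_assoc, mul_smul_comm, mul_assoc,
      hP, hQ, hr, hP', hQ', hr']
    module
  · simp only [nextQ, mul_add, add_mul, mul_sub, sub_mul, mul_neg, smul_mul_assoc,
      mul_smul_comm, mul_assoc, hP, hQ, hr, hP', hQ', hr']
    module

/-- A generator supercommutes with the pair obtained two steps later. -/
theorem supercommute_next_next (hr : r * r = (-e ^ 2 - 2) • (1 : A))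
    (hs : s * s = (-e ^ 2 - 2) • (1 : A))
    (hb : r * s * r - s * r * s = e ^ 2 • (s - r))
    (hP : s * P = P * s) (hQ : s * Q = -(Q * s)) :
    r * nextP e s (nextP e r P Q) (nextQ e r P Q) =
        nextP e s (nextP e r P Q) (nextQ e r P Q) * r ∧
      r * nextQ e s (nextP e r P Q) (nextQ e r P Q) =
        -(nextQ e s (nextP e r P Q) (nextQ e r P Q) * r) := by
  -- The braid relation is oriented as a rewrite rule `rsr → srs`; both sides then reduce to
  -- combinations of the same words, compared linearly.
  have hb1 : r * (s * r) = s * (r * s) + e ^ 2 • (s - r) := by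
    rw [← mul_assoc, ← mul_assoc, ← hb]; abel
  have hb2 (x : A) : r * (s * (r * x)) = s * (r * (s * x)) + e ^ 2 • (s * x - r * x) := by
    have := congrArg (· * x) hb1
    simpa only [mul_assoc, add_mul, sub_mul, smul_mul_assoc] using this
  have hP' (x : A) : s * (P * x) = P * (s * x) := by rw [← mul_assoc, hP, mul_assoc]
  have hQ' (x : A) : s * (Q * x) = -(Q * (s * x)) := by rw [← mul_assoc, hQ, neg_mul, mul_assoc]
  constructor
  · simp only [nextP, nextQ, mul_add, add_mul, mul_sub, sub_mul, neg_mul, mul_neg, smul_mul_assoc,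
      mul_smul_comm, mul_assoc, smul_add, smul_sub, smul_neg, hP, hQ, hP', hQ', hr, hs,
      mul_self_mul hr, mul_self_mul hs, hb1, hb2, mul_one]
    module
  · simp only [nextP, nextQ, mul_add, add_mul, mul_sub, sub_mul, neg_mul, mul_neg, smul_mul_assoc,
      mul_smul_comm, mul_assoc, smul_add, smul_sub, smul_neg, hP, hQ, hP', hQ', hr, hs,
      mul_self_mul hr, mul_self_mul hs, hb1, hb2, mul_one]
    module

end Recursion

/-! ### Relations among the Jucys–Murphy elements. -/

section Generators

variable {n : ℕ}

theorem R_mul_self (i : Fin (n - 1)) : (R i : Alg n) * R i = (-eps ^ 2 - 2) • (1 : Alg n) := by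
  have := RingQuot.mkAlgHom_rel K (Rel.sq i)
  rwa [map_pow, AlgHom.commutes, sq, Algebra.algebraMap_eq_smul_one] at this

theorem R_anticomm (i j : Fin (n - 1)) (h : i.1 + 1 < j.1 ∨ j.1 + 1 < i.1) :
    (R i : Alg n) * R j = -(R j * R i) := by
  have := RingQuot.mkAlgHom_rel K (Rel.anticomm i j h)
  rwa [map_mul, map_neg, map_mul] at this

theorem R_braid (i j : Fin (n - 1)) (h : j.1 = i.1 + 1) :
    (R i : Alg n) * R j * R i - R j * R i * R j = eps ^ 2 • (R j - R i) := by
  have := RingQuot.mkAlgHom_rel K (Rel.braid i j h)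
  simp only [map_sub, map_mul, map_smul] at this
  exact this

theorem jm_lo_hi (i : Fin (n - 1)) :
    (jmP (hi i) : Alg n) = nextP eps (R i) (jmP (lo i)) (jmQ (lo i)) ∧
      (jmQ (hi i) : Alg n) = nextQ eps (R i) (jmP (lo i)) (jmQ (lo i)) :=
  ⟨rfl, rfl⟩

/-- Induction along `Fin n` in steps from `lo i` to `hi i`. -/
theorem fin_step_induction {C : Fin n → Prop} (zero : ∀ h : 0 < n, C ⟨0, h⟩)
    (step : ∀ i : Fin (n - 1), C (lo i) → C (hi i)) (j : Fin n) : C j := by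
  obtain ⟨k, hk⟩ := j
  induction k with
  | zero => exact zero hk
  | succ k ih => exact step ⟨k, by omega⟩ (ih (by omega))

theorem jm_circle (j : Fin n) :
    (jmP j : Alg n) * jmP j + jmQ j * jmQ j = 1 ∧ (jmP j : Alg n) * jmQ j = jmQ j * jmP j := by
  induction j using fin_step_induction with
  | zero h => simp [jmP, jmQ, jucysMurphy]
  | step i ih =>
    rw [(jm_lo_hi i).1, (jm_lo_hi i).2]
    exact next_circle (R_mul_self i) ih.1 ih.2

/-- The pair at `j` involves only `R k` with `k < j`, all at distance more than one from `R i`. -/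
theorem R_jm_of_lt (i : Fin (n - 1)) (j : Fin n) (h : j.1 < i.1) :
    (R i : Alg n) * jmP j = jmP j * R i ∧ (R i : Alg n) * jmQ j = -(jmQ j * R i) := by
  induction j using fin_step_induction with
  | zero h => simp [jmP, jmQ, jucysMurphy]
  | step k ih =>
    have hk : k.1 + 1 < i.1 := h
    obtain ⟨h1, h2⟩ := ih (Nat.lt_of_succ_lt hk)
    rw [(jm_lo_hi k).1, (jm_lo_hi k).2]
    exact supercommute_next h1 h2 (R_anticomm i k (Or.inr hk))

theorem R_jm_of_gt (i : Fin (n - 1)) (j : Fin n) (h : i.1 + 1 < j.1) :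
    (R i : Alg n) * jmP j = jmP j * R i ∧ (R i : Alg n) * jmQ j = -(jmQ j * R i) := by
  induction j using fin_step_induction with
  | zero h' => exact absurd h (Nat.not_lt_zero _)
  | step k ih =>
    have hk : i.1 + 1 < k.1 + 1 := h
    -- If `k = i + 1`, the pair at `hi k` lies two steps above `lo i` and the braid relation is
    -- needed; otherwise `R k` is far from `R i`.
    rcases (Nat.lt_succ_iff.mp hk).eq_or_lt with hik | hik
    · have hlo : (lo k : Fin n) = hi i := Fin.ext hik.symm
      obtain ⟨h1, h2⟩ := R_jm_of_lt k (lo i) (show i.1 < k.1 by omega)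
      rw [(jm_lo_hi k).1, (jm_lo_hi k).2, hlo, (jm_lo_hi i).1, (jm_lo_hi i).2]
      exact supercommute_next_next (R_mul_self i) (R_mul_self k) (R_braid i k hik.symm) h1 h2
    · obtain ⟨h1, h2⟩ := ih hik
      rw [(jm_lo_hi k).1, (jm_lo_hi k).2]
      exact supercommute_next h1 h2 (R_anticomm i k (Or.inl hik))

theorem R_jm_far (i : Fin (n - 1)) (j : Fin n) (h : j ≠ lo i) (h' : j ≠ hi i) :
    (R i : Alg n) * jmP j = jmP j * R i ∧ (R i : Alg n) * jmQ j = -(jmQ j * R i) := by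
  have h1 : j.1 ≠ i.1 := fun he => h (Fin.ext he)
  have h2 : j.1 ≠ i.1 + 1 := fun he => h' (Fin.ext he)
  rcases lt_or_gt_of_ne h1 with h3 | h3
  · exact R_jm_of_lt i j h3
  · exact R_jm_of_gt i j (by omega)

/-- Induction on the smaller index works because each `R k` used to build the lower pair has `k + 1
< j`, so `R_jm_of_gt` applies. -/
theorem jmP_commute_of_lt (j i : Fin n) (h : i.1 < j.1) :
    (jmP j : Alg n) * jmP i = jmP i * jmP j ∧ (jmP j : Alg n) * jmQ i = jmQ i * jmP j := by
  induction i using fin_step_induction with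
  | zero h => simp [jmP, jmQ, jucysMurphy]
  | step k ih =>
    have hk : k.1 + 1 < j.1 := h
    obtain ⟨h1, h2⟩ := ih (Nat.lt_of_succ_lt hk)
    rw [(jm_lo_hi k).1, (jm_lo_hi k).2]
    exact commute_next h1 h2 (R_jm_of_gt k j hk).1.symm

theorem jmQ_supercommute_of_lt (j i : Fin n) (h : i.1 < j.1) :
    (jmQ j : Alg n) * jmP i = jmP i * jmQ j ∧ (jmQ j : Alg n) * jmQ i = -(jmQ i * jmQ j) := by
  induction i using fin_step_induction with
  | zero h => simp [jmP, jmQ, jucysMurphy]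
  | step k ih =>
    have hk : k.1 + 1 < j.1 := h
    obtain ⟨h1, h2⟩ := ih (Nat.lt_of_succ_lt hk)
    rw [(jm_lo_hi k).1, (jm_lo_hi k).2]
    -- Here `jmQ j` itself plays the role of the odd element `t`.
    exact supercommute_next h1 h2 (neg_eq_iff_eq_neg.mp (R_jm_of_gt k j hk).2.symm)

theorem jmP_mul_jmP (i j : Fin n) : (jmP i : Alg n) * jmP j = jmP j * jmP i := by
  rcases lt_trichotomy i.1 j.1 with h | h | h
  · exact (jmP_commute_of_lt j i h).1.symm
  · rw [Fin.ext h]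
  · exact (jmP_commute_of_lt i j h).1

theorem jmQ_mul_jmQ (i j : Fin n) (hij : i ≠ j) :
    (jmQ i : Alg n) * jmQ j = -(jmQ j * jmQ i) := by
  rcases lt_trichotomy i.1 j.1 with h | h | h
  · exact neg_eq_iff_eq_neg.mp (jmQ_supercommute_of_lt j i h).2.symm
  · exact absurd (Fin.ext h) hij
  · exact (jmQ_supercommute_of_lt i j h).2

theorem jmP_mul_jmQ (i j : Fin n) : (jmP i : Alg n) * jmQ j = jmQ j * jmP i := by
  rcases lt_trichotomy i.1 j.1 with h | h | h
  · exact (jmQ_supercommute_of_lt j i h).1.symm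
  · rw [Fin.ext h]; exact (jm_circle j).2
  · exact (jmP_commute_of_lt i j h).2

/-! ### Existence of the homomorphism. -/

/-- The images of the generators of the affine algebra. -/
noncomputable def genImage (n : ℕ) : Gen n → Alg n
  | Gen.R i => R i
  | Gen.p i => jmP i
  | Gen.q i => jmQ i

theorem genImage_rel (n : ℕ) ⦃x y : FreeAlgebra K (Gen n)⦄ (h : AffRel n x y) :
    FreeAlgebra.lift K (genImage n) x = FreeAlgebra.lift K (genImage n) y := by
  cases h <;>
    simp only [map_mul, map_add, map_sub, map_neg, map_smul, map_pow, map_one, AlgHom.commutes,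
      FreeAlgebra.lift_ι_apply, genImage]
  case sq i => rw [sq, R_mul_self, Algebra.smul_def]; simp
  case anticomm i j h => exact R_anticomm i j h
  case braid i j h => exact R_braid i j h
  case pp i j => exact jmP_mul_jmP i j
  case qq i j h => exact jmQ_mul_jmQ i j h
  case circle i => rw [sq, sq]; exact (jm_circle i).1
  case pq i j => exact jmP_mul_jmQ i j
  case Rp_far i j h h' => exact (R_jm_far i j h h').1
  case Rq_far i j h h' => exact (R_jm_far i j h h').2
  case Rp i => rw [(jm_lo_hi i).1, (jm_lo_hi i).2]; exact mul_P_eq (R_mul_self i)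
  case Rq i => rw [(jm_lo_hi i).1, (jm_lo_hi i).2]; exact mul_Q_eq (R_mul_self i)

/-- The Jucys-Murphy homomorphism. -/
noncomputable def jmHom (n : ℕ) : Aff n →ₐ[K] Alg n :=
  RingQuot.liftAlgHom K ⟨FreeAlgebra.lift K (genImage n), genImage_rel n⟩

theorem jmHom_aR (i : Fin (n - 1)) : jmHom n (aR i) = R i := by
  simp [jmHom, aR, gR, genImage]

theorem jmHom_p (i : Fin n) : jmHom n (p i) = jmP i := by
  simp [jmHom, p, gp, genImage]

theorem jmHom_q (i : Fin n) : jmHom n (q i) = jmQ i := by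
  simp [jmHom, q, gq, genImage]

theorem isJM_jmHom (hn : 0 < n) : IsJM hn (jmHom n) where
  extends_id x := by
    have : (jmHom n).comp (incl n) = AlgHom.id K (Alg n) := by
      apply RingQuot.ringQuot_ext'
      apply FreeAlgebra.hom_ext
      funext i
      exact (congrArg (jmHom n) (incl_R i)).trans (jmHom_aR i)
    exact DFunLike.congr_fun this x
  map_p := jmHom_p _
  map_q := jmHom_q _

/-! ### Uniqueness and the recursive formulas. -/

theorem IsJM.map_aR {hn : 0 < n} {JM : Aff n →ₐ[K] Alg n} (h : IsJM hn JM) (i : Fin (n - 1)) :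
    JM (aR i) = R i := by
  rw [← incl_R, h.extends_id]

theorem IsJM.map_p_q {hn : 0 < n} {JM : Aff n →ₐ[K] Alg n} (h : IsJM hn JM) (j : Fin n) :
    JM (p j) = jmP j ∧ JM (q j) = jmQ j := by
  induction j using fin_step_induction with
  | zero _ => exact ⟨h.map_p, h.map_q⟩
  | step i ih =>
    have hp : (aR i : Aff n) * p (lo i) = p (hi i) * aR i + eps • (q (lo i) - q (hi i)) := by
      have := RingQuot.mkAlgHom_rel K (AffRel.Rp i)
      simp only [map_mul, map_add, map_sub, map_smul] at this
      exact this
    have hq : (aR i : Aff n) * q (lo i) = -(q (hi i) * aR i) - eps • (p (lo i) + p (hi i)) := by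
      have := RingQuot.mkAlgHom_rel K (AffRel.Rq i)
      simp only [map_mul, map_add, map_sub, map_neg, map_smul] at this
      exact this
    -- The images under `JM` satisfy the exchange relations, which leave no freedom for the next
    -- pair.
    have hp' := congrArg JM hp
    have hq' := congrArg JM hq
    simp only [map_mul, map_add, map_sub, map_neg, map_smul, h.map_aR, ih.1, ih.2] at hp' hq'
    rw [(jm_lo_hi i).1, (jm_lo_hi i).2]
    exact eq_next (R_mul_self i) hp' hq'

theorem IsJM.eq_jmHom {hn : 0 < n} {JM : Aff n →ₐ[K] Alg n} (h : IsJM hn JM) :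
    JM = jmHom n := by
  apply RingQuot.ringQuot_ext'
  apply FreeAlgebra.hom_ext
  funext g
  cases g with
  | R i => exact (h.map_aR i).trans (jmHom_aR i).symm
  | p i => exact (h.map_p_q i).1.trans (jmHom_p i).symm
  | q i => exact (h.map_p_q i).2.trans (jmHom_q i).symm

end Generators

end SpinHecke

theorem mainTheorem11 (n : ℕ) (hn : 0 < n) :
    (∃! JM : SpinHecke.Aff n →ₐ[SpinHecke.K] SpinHecke.Alg n, SpinHecke.IsJM hn JM) ∧
    (∀ JM : SpinHecke.Aff n →ₐ[SpinHecke.K] SpinHecke.Alg n, SpinHecke.IsJM hn JM →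
      ∀ i : Fin n, JM (SpinHecke.p i) = SpinHecke.jmP i ∧
        JM (SpinHecke.q i) = SpinHecke.jmQ i) :=
  ⟨⟨SpinHecke.jmHom n, SpinHecke.isJM_jmHom hn, fun _ h => h.eq_jmHom⟩,
    fun _ h i => h.map_p_q i⟩
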